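/- Let $G$ be a finite simple graph. A tree decomposition of $G$ consists of a finite tree $T$ and bags $X_t\subseteq V(G)$ ($t\in V(T)$) such that every vertex of $G$ lies in some bag, both ends of every edge of $G$ lie in a common bag, and $X_a\cap X_b\subseteq X_s$ whenever $s$ is on the path of $T$ between $a$ and $b$. The treewidth $\mathrm{tw}(G)$ is the least integer $k\ge 0$ such that $G$ has a tree decomposition with $|X_t|\le k+1$ for all $t$. For an injection $L\colon V(G)\to\mathbb N$ (a linear order of $V(G)$) and an integer $r\ge 0$, a vertex $u$ is weakly $r$-reachable from $v$ if there is a path from $v$ to $u$ of length at most $r$ (possibly $0$) all of whose vertices $w$ satisfy $L(u)\le L(w)$; $\mathrm{WReach}_r[G,L,v]$ denotes the set of these $u$. The weak $r$-colouring number is $$\mathrm{wcol}_r(G)=\min_{L}\max_{v\in V(G)}|\mathrm{WReach}_r[G,L,v]|.$$ **Theorem.** For all integers $k\ge 0$ and $r\ge 0$ there is a finite simple graph $G^k_r$ with $\mathrm{tw}(G^k_r)=k$ such that, for every integer $r'$ with $0\le r'\le r$, $$\mathrm{wcol}_{r'}(G^k_r)=\binom{r'+k}{k}.$$ In particular $\mathrm{wcol}_r(G^k_r)=\binom{r+k}{k}$.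 -/

import Mathlib

namespace SimpleGraph

/-- A tree decomposition of `G` over the (finite) tree `T`: a family of bags, indexed by the nodes
of `T`, which cover all vertices and all edges, and such that every bag on the path of `T` between
two nodes contains the intersection of the bags at these two nodes. -/
structure TreeDecomposition {V : Type*} (G : SimpleGraph V) {ι : Type*} (T : SimpleGraph ι) where
  isTree : T.IsTree
  bag : ι → Finset V
  cover_vertex : ∀ v : V, ∃ t, v ∈ bag t
  cover_edge : ∀ u v : V, G.Adj u v → ∃ t, u ∈ bag t ∧ v ∈ bag t
  inter_subset : ∀ (a s b : ι) (p : T.Walk a b), p.IsPath → s ∈ p.support →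
    ∀ v : V, v ∈ bag a → v ∈ bag b → v ∈ bag s

/-- `G` has treewidth at most `k`: some tree decomposition of `G` over a finite tree has all its
bags of size at most `k + 1`. -/
def TreewidthAtMost {V : Type*} (G : SimpleGraph V) (k : ℕ) : Prop :=
  ∃ (ι : Type) (_ : Finite ι) (T : SimpleGraph ι) (D : G.TreeDecomposition T),
    ∀ t, (D.bag t).card ≤ k + 1

/-- The treewidth of a (finite) graph: the least `k` such that it has treewidth at most `k`. -/
noncomputable def treewidth {V : Type*} (G : SimpleGraph V) : ℕ :=
  sInf {k | G.TreewidthAtMost k}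

/-- The minimum in the definition of the treewidth of a finite graph is attained. -/
theorem treewidthAtMost_treewidth {V : Type*} [Fintype V] (G : SimpleGraph V) :
    G.TreewidthAtMost G.treewidth := by
  refine Nat.sInf_mem (s := {k | G.TreewidthAtMost k}) ⟨Fintype.card V, ?_⟩
  refine ⟨Unit, inferInstance, ⊥, ⟨IsTree.of_subsingleton, fun _ => Finset.univ, ?_, ?_, ?_⟩, ?_⟩
  · exact fun v => ⟨(), Finset.mem_univ v⟩
  · exact fun u v _ => ⟨(), Finset.mem_univ u, Finset.mem_univ v⟩
  · exact fun _ _ _ _ _ _ v _ _ => Finset.mem_univ v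
  · intro t
    exact (Finset.card_univ (α := V)).le.trans (Nat.le_succ _)

/-- `G.WReach L r v` is the set of vertices `u` that are weakly `r`-reachable from `v` with respect
to the order `L`: some path of length at most `r` (possibly `0`) from `v` to `u` has `u` as its
`L`-least vertex. -/
def WReach {V : Type*} (G : SimpleGraph V) (L : V → ℕ) (r : ℕ) (v : V) : Set V :=
  {u | ∃ p : G.Walk v u, p.IsPath ∧ p.length ≤ r ∧ ∀ w ∈ p.support, L u ≤ L w}

/-- The weak `r`-colouring number of a finite graph: the minimum over all linear orders of the
vertices, given as injections `L : V ↪ ℕ`, of the maximum over all vertices `v` of the number of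
vertices that are weakly `r`-reachable from `v`. -/
noncomputable def wcol {V : Type*} [Fintype V] (G : SimpleGraph V) (r : ℕ) : ℕ :=
  ⨅ L : V ↪ ℕ, Finset.univ.sup fun v : V => (G.WReach L r v).ncard

end SimpleGraph

/-! Both bounds follow Pascal's rule. For the lower bound, the graph for `(k + 1, r + 1)` arises
from the graph `G` for `(k + 1, r)` by joining each vertex to many copies of the graph `H` for `(k,
r + 1)`. Given an order, let `x` reach many vertices inside `G`. If a copy at `x` lies wholly after
`x`, its best vertex reaches its targets in `H` and, through `x`, those of `x`. Otherwise `x`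
reaches a vertex of every copy in one step (`WReachAtLeast.attachCopies`).

For the upper bound, these graphs have elimination orders of width `k`. There a walk ending at its
least vertex can be replaced by a descending one that is no longer (`mem_stepReach_of_walk`), and
`ncard_stepReach_le` counts descents. The elimination order and a clique on `k + 1` vertices fix the
treewidth. -/

namespace SimpleGraph

/-! ### Counting descents -/

/-- The set of elements which can be reached from `v` in at most `n` steps of the relation `E`. -/
def stepReach {V : Type*} (E : V → V → Prop) : ℕ → V → Set V
  | 0, v => {v}
  | n + 1, v => {v} ∪ ⋃ a ∈ {a | E v a}, stepReach E n a

section stepReach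

variable {V : Type*} {E : V → V → Prop}

theorem mem_stepReach_succ {n : ℕ} {u v : V} :
    u ∈ stepReach E (n + 1) v ↔ u = v ∨ ∃ a, E v a ∧ u ∈ stepReach E n a := by
  simp [stepReach]

theorem self_mem_stepReach (n : ℕ) (v : V) : v ∈ stepReach E n v := by
  cases n <;> simp [stepReach]

theorem stepReach_succ_subset (n : ℕ) (v : V) : stepReach E n v ⊆ stepReach E (n + 1) v := by
  induction n generalizing v with
  | zero => rintro u rfl; exact self_mem_stepReach _ _
  | succ n ih =>
    intro u hu
    rcases mem_stepReach_succ.1 hu with rfl | ⟨a, ha, hu⟩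
    · exact self_mem_stepReach _ _
    · exact mem_stepReach_succ.2 (Or.inr ⟨a, ha, ih a hu⟩)

theorem le_of_mem_stepReach {L : V → ℕ} (hL : ∀ v a, E v a → L a < L v) {n : ℕ} {u v : V}
    (h : u ∈ stepReach E n v) : L u ≤ L v := by
  induction n generalizing v with
  | zero => exact (congrArg L h).le
  | succ n ih =>
    rcases mem_stepReach_succ.1 h with rfl | ⟨a, ha, hu⟩
    · exact le_rfl
    · exact (ih hu).trans (hL _ _ ha).le

/-- The first step `a` of a descent from `v` is comparable with `p`: if `a` is above `p`, recurse
from `a`; if below, `p` steps to `a` directly. -/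
theorem mem_stepReach_of_le {L : V → ℕ} (hL : ∀ v a, E v a → L a < L v)
    (hE : ∀ v a b, E v a → E v b → a = b ∨ E a b ∨ E b a) {n : ℕ} {u v p : V}
    (hp : E v p) (h : u ∈ stepReach E n v) (hu : L u ≤ L p) : u ∈ stepReach E n p := by
  induction n generalizing v with
  | zero =>
    rw [stepReach, Set.mem_singleton_iff] at h
    subst h
    exact absurd (hL _ _ hp) hu.not_gt
  | succ n ih =>
    rcases mem_stepReach_succ.1 h with rfl | ⟨a, ha, hua⟩
    · exact absurd (hL _ _ hp) hu.not_gt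
    · rcases hE v a p ha hp with rfl | h | h
      · exact stepReach_succ_subset _ _ hua
      · exact stepReach_succ_subset _ _ (ih h hua)
      · exact mem_stepReach_succ.2 (Or.inr ⟨a, h, hua⟩)

/-- A descent ending above `p` stays above `p`, so each of its elements again has `p` as a
successor. Discarding `p` lowers the clique bound by one. -/
theorem mem_stepReach_restrict {L : V → ℕ} (hL : ∀ v a, E v a → L a < L v)
    (hE : ∀ v a b, E v a → E v b → a = b ∨ E a b ∨ E b a) {n : ℕ} {u v p : V}
    (hp : E v p) (h : u ∈ stepReach E n v) (hu : L p < L u) :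
    u ∈ stepReach (fun w a => E w p ∧ E w a ∧ L p < L a) n v := by
  induction n generalizing v with
  | zero => exact h
  | succ n ih =>
    rcases mem_stepReach_succ.1 h with rfl | ⟨a, ha, hua⟩
    · exact self_mem_stepReach _ _
    · have hpa : L p < L a := hu.trans_le (le_of_mem_stepReach hL hua)
      have hap : E a p := by
        rcases hE v a p ha hp with rfl | h | h
        · exact absurd hpa (lt_irrefl _)
        · exact h
        · exact absurd (hL _ _ h) hpa.not_gt
      exact mem_stepReach_succ.2 (Or.inr ⟨a, ⟨hp, ha, hpa⟩, ih hap hua⟩)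

/-- If the successors of each element under a decreasing relation `E` form a clique of size at
most `k`, then at most `(n + k).choose k` elements are reachable in at most `n` steps. -/
theorem ncard_stepReach_le [Finite V] {L : V → ℕ} (hL : ∀ v a, E v a → L a < L v)
    (hE : ∀ v a b, E v a → E v b → a = b ∨ E a b ∨ E b a) {k : ℕ}
    (hk : ∀ v, {a | E v a}.ncard ≤ k) (n : ℕ) (v : V) :
    (stepReach E n v).ncard ≤ (n + k).choose k := by
  induction k generalizing E n v with
  | zero =>
    have hsub : stepReach E n v ⊆ {v} := by
      cases n with
      | zero => exact le_rfl
      | succ n =>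
        intro u hu
        rcases mem_stepReach_succ.1 hu with rfl | ⟨a, ha, -⟩
        · rfl
        · have := (Set.ncard_eq_zero (Set.toFinite _)).1 (Nat.le_zero.1 (hk v))
          exact absurd (show a ∈ {a | E v a} from ha) (by simp [this])
    simpa using Set.ncard_le_ncard hsub
  | succ k ihk =>
    induction n generalizing v with
    | zero => simp [stepReach]
    | succ n ihn =>
      rcases Set.eq_empty_or_nonempty {a | E v a} with h0 | hne
      · have : stepReach E (n + 1) v = {v} := by simp [stepReach, h0]
        rw [this, Set.ncard_singleton]
        exact Nat.choose_pos (by omega)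
      -- With `p` the lowest successor, targets up to `p` are reached from `p` in `n` steps and the
      -- others by the restricted relation: the two terms of Pascal's rule.
      obtain ⟨p, hp, hmin⟩ := Set.exists_min_image _ L (Set.toFinite _) hne
      have hsub : stepReach E (n + 1) v ⊆ stepReach E n p ∪
          stepReach (fun w a => E w p ∧ E w a ∧ L p < L a) (n + 1) v := by
        intro u hu
        rcases lt_or_ge (L p) (L u) with hpu | hup
        · exact Or.inr (mem_stepReach_restrict hL hE hp hu hpu)
        · left
          rcases mem_stepReach_succ.1 hu with rfl | ⟨a, ha, hua⟩
          · exact absurd (hL _ _ hp) hup.not_gt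
          · rcases hE v a p ha hp with rfl | h | h
            · exact hua
            · exact mem_stepReach_of_le hL hE h hua hup
            · exact absurd (hL _ _ h) (hmin a ha).not_gt
      have hcard := ihk (E := fun w a => E w p ∧ E w a ∧ L p < L a)
        (fun w a h => hL w a h.2.1) (by
          rintro w a b ⟨hwp, hwa, hpa⟩ ⟨-, hwb, hpb⟩
          have key : ∀ c, E w c → L p < L c → E c p := fun c hc hpc => by
            rcases hE w c p hc hwp with rfl | h | h
            · exact absurd hpc (lt_irrefl _)
            · exact h
            · exact absurd (hL _ _ h) hpc.not_gt
          rcases hE w a b hwa hwb with h | h | h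
          · exact Or.inl h
          · exact Or.inr (Or.inl ⟨key a hwa hpa, h, hpb⟩)
          · exact Or.inr (Or.inr ⟨key b hwb hpb, h, hpa⟩)) (by
          intro w
          by_cases hwp : E w p
          · have hlt : {a | E w p ∧ E w a ∧ L p < L a} ⊂ {a | E w a} :=
              ⟨fun a ha => ha.2.1, fun h => lt_irrefl _ (h (show p ∈ {a | E w a} from hwp)).2.2⟩
            have := Set.ncard_lt_ncard hlt
            have := hk w
            omega
          · simp [hwp]) (n + 1) v
      calc _ ≤ _ := Set.ncard_le_ncard hsub
        _ ≤ _ := Set.ncard_union_le _ _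
        _ ≤ _ := add_le_add (ihn p) hcard
        _ = (n + 1 + (k + 1)).choose (k + 1) := by
          rw [show n + 1 + (k + 1) = (n + k + 1) + 1 by omega, Nat.choose_succ_succ, add_comm,
            show n + 1 + k = n + k + 1 by omega, show n + (k + 1) = n + k + 1 by omega]

end stepReach

/-! ### Elimination orders and the upper bound -/

/-- `G` has an elimination order of width at most `k`: an order of the vertices in which the
earlier neighbours of each vertex form a clique of size at most `k`. -/
def HasEliminationOrder {V : Type*} (G : SimpleGraph V) (k : ℕ) : Prop :=
  ∃ L : V ↪ ℕ, ∀ v, G.IsClique {a | G.Adj v a ∧ L a < L v} ∧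
    {a | G.Adj v a ∧ L a < L v}.ncard ≤ k

theorem eq_or_earlier_of_isClique {V : Type*} {G : SimpleGraph V} {L : V ↪ ℕ}
    (hL : ∀ v, G.IsClique {a | G.Adj v a ∧ L a < L v}) (v a b : V)
    (ha : G.Adj v a ∧ L a < L v) (hb : G.Adj v b ∧ L b < L v) :
    a = b ∨ (G.Adj a b ∧ L b < L a) ∨ (G.Adj b a ∧ L a < L b) := by
  by_cases hab : a = b
  · exact Or.inl hab
  · have h := hL v ha hb hab
    rcases lt_or_gt_of_ne (L.injective.ne hab) with h' | h'
    · exact Or.inr (Or.inr ⟨h.symm, h'⟩)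
    · exact Or.inr (Or.inl ⟨h, h'⟩)

theorem mem_stepReach_of_walk {V : Type*} {G : SimpleGraph V} {L : V ↪ ℕ}
    (hL : ∀ v, G.IsClique {a | G.Adj v a ∧ L a < L v}) {v u : V} (p : G.Walk v u)
    (hp : ∀ w ∈ p.support, L u ≤ L w) {n : ℕ} (hn : p.length ≤ n) :
    u ∈ stepReach (fun v a => G.Adj v a ∧ L a < L v) n v := by
  induction p generalizing n with
  | nil => exact self_mem_stepReach _ _
  | @cons v w u h p ih =>
    rw [Walk.length_cons] at hn
    obtain ⟨n, rfl⟩ : ∃ m, n = m + 1 := ⟨n - 1, by omega⟩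
    have ih' := ih (fun x hx => hp x (by simp [hx])) (n := n) (by omega)
    rcases lt_or_gt_of_ne (L.injective.ne h.ne) with h' | h'
    -- The walk first ascends to `w`; since `v` is an earlier neighbour of `w` and `u` is not after
    -- `v`, the descent from `w` can start at `v` instead.
    · exact stepReach_succ_subset _ _ (mem_stepReach_of_le (fun _ _ h => h.2)
        (eq_or_earlier_of_isClique hL) ⟨h.symm, h'⟩ ih' (hp v (by simp)))
    · exact mem_stepReach_succ.2 (Or.inr ⟨w, ⟨h, h'⟩, ih'⟩)

theorem HasEliminationOrder.wcol_le {V : Type*} [Fintype V] {G : SimpleGraph V} {k : ℕ}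
    (h : G.HasEliminationOrder k) (r : ℕ) : G.wcol r ≤ (r + k).choose k := by
  obtain ⟨L, hL⟩ := h
  refine (ciInf_le' _ L).trans (Finset.sup_le fun v _ => ?_)
  refine (Set.ncard_le_ncard (t := stepReach (fun v a => G.Adj v a ∧ L a < L v) r v) ?_).trans
    (ncard_stepReach_le (L := L) (fun _ _ h => h.2)
      (eq_or_earlier_of_isClique fun v => (hL v).1) (fun v => (hL v).2) r v)
  rintro u ⟨p, -, hlen, hp⟩
  exact mem_stepReach_of_walk (fun v => (hL v).1) p hp hlen

/-! ### Treewidth -/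

/-- A finite graph with vertex set `Option V` whose edges join each `some v` to a node of smaller
rank is a tree. -/
theorem isTree_of_parent {V : Type*} [Finite V] (L : V → ℕ) (par : V → Option V)
    (hpar : ∀ v w, par v = some w → L w < L v) :
    (fromEdgeSet (Set.range fun v => s(some v, par v))).IsTree := by
  set T := fromEdgeSet (Set.range fun v => s(some v, par v)) with hT
  have hadj : ∀ v, T.Adj (some v) (par v) := by
    intro v
    rw [hT, fromEdgeSet_adj]
    exact ⟨⟨v, rfl⟩, fun h => lt_irrefl _ (hpar v v h.symm)⟩
  have hreach : ∀ n, ∀ v, L v = n → T.Reachable (some v) none := by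
    intro n
    induction n using Nat.strong_induction_on with
    | _ n ih =>
      rintro v rfl
      refine (hadj v).reachable.trans ?_
      rcases h : par v with _ | w
      · exact Reachable.refl _
      · exact ih _ (hpar v w h) w rfl
  have hreach' : ∀ x, T.Reachable x none := by
    rintro (_ | v)
    · exact Reachable.refl _
    · exact hreach _ v rfl
  have hconn : T.Connected :=
    { preconnected := fun x y => (hreach' x).trans (hreach' y).symm
      nonempty := ⟨none⟩ }
  rw [isTree_iff_connected_and_card]
  refine ⟨hconn, le_antisymm ?_ hconn.card_vert_le_card_edgeSet_add_one⟩
  have hsub : T.edgeSet ⊆ Set.range fun v => s(some v, par v) := by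
    rw [hT, edgeSet_fromEdgeSet]
    exact Set.sdiff_subset
  have h1 : Nat.card T.edgeSet ≤ Nat.card (Set.range fun v => s(some v, par v)) :=
    Nat.card_mono (Set.toFinite _) hsub
  have h2 : Nat.card (Set.range fun v => s(some v, par v)) ≤ Nat.card V :=
    Finite.card_range_le _
  have h3 : Nat.card (Option V) = Nat.card V + 1 := Finite.card_option
  omega

theorem IsAcyclic.support_subset_of_isPath {V : Type*} {T : SimpleGraph V} (hT : T.IsAcyclic)
    {a b : V} {p : T.Walk a b} (hp : p.IsPath) (q : T.Walk a b) : p.support ⊆ q.support := by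
  classical
  have : p = q.bypass := congrArg Subtype.val
    ((hT.subsingleton_path a b).elim ⟨p, hp⟩ ⟨q.bypass, q.bypass_isPath⟩)
  rw [this]
  exact q.support_bypass_subset_support

/-- In a tree decomposition, every clique is contained in a bag. -/
theorem TreeDecomposition.exists_bag_of_isClique {V ι : Type*} {G : SimpleGraph V}
    {T : SimpleGraph ι} (D : G.TreeDecomposition T) (s : Finset V) (hs : G.IsClique (s : Set V)) :
    ∃ t, s ⊆ D.bag t := by
  have hconn := D.isTree.1
  obtain ⟨ρ⟩ := hconn.nonempty
  rcases s.eq_empty_or_nonempty with rfl | hne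
  · exact ⟨ρ, by simp⟩
  have htop : ∀ v, ∃ t, v ∈ D.bag t ∧ ∀ t', v ∈ D.bag t' → T.dist t ρ ≤ T.dist t' ρ := by
    intro v
    obtain ⟨t, ht, hmin⟩ := WellFounded.has_min
      (InvImage.wf (fun t => T.dist t ρ) Nat.lt_wfRel.wf) {t | v ∈ D.bag t} (D.cover_vertex v)
    exact ⟨t, ht, fun t' ht' => not_lt.1 (hmin t' ht')⟩
  choose top htop hmin using htop
  -- every path from a bag containing `v` to the root passes through `top v`
  have hpath : ∀ v x, v ∈ D.bag x → ∃ (q : T.Walk x (top v)) (p : T.Walk (top v) ρ),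
      (q.append p).IsPath ∧ (∀ y ∈ q.support, v ∈ D.bag y) ∧
      ∀ y ∈ p.support, y = top v ∨ T.dist y ρ < T.dist (top v) ρ := by
    intro v x hx
    obtain ⟨q, hq, -⟩ := hconn.exists_path_of_dist x (top v)
    obtain ⟨p, hp, hlen⟩ := hconn.exists_path_of_dist (top v) ρ
    have hqb : ∀ y ∈ q.support, v ∈ D.bag y := fun y hy =>
      D.inter_subset x y (top v) q hq hy v hx (htop v)
    have hlt : ∀ y ∈ p.support.tail, T.dist y ρ < T.dist (top v) ρ := by
      cases p with
      | nil => simp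
      | cons h p =>
        classical
        intro y hy
        rw [Walk.support_cons, List.tail_cons] at hy
        have h1 := dist_le (p.dropUntil y hy)
        have h2 := p.length_dropUntil_le_length hy
        rw [Walk.length_cons] at hlen
        omega
    refine ⟨q, p, ?_, hqb, fun y hy => (p.mem_support_iff.1 hy).imp_right (hlt y)⟩
    rw [Walk.isPath_def, Walk.support_append, List.nodup_append']
    refine ⟨hq.support_nodup, hp.support_nodup.tail, ?_⟩
    intro y hy hy'
    exact (hmin v y (hqb y hy)).not_gt (hlt y hy')
  -- The bag at the top node farthest from the root works: `top v` lies on the route from a common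
  -- bag via `top u` to the root, and not strictly beyond `top u`.
  obtain ⟨v, hv, hvmax⟩ := s.exists_max_image (fun v => T.dist (top v) ρ) hne
  refine ⟨top v, fun u hu => ?_⟩
  by_cases huv : u = v
  · exact huv ▸ htop u
  obtain ⟨x, hxu, hxv⟩ := D.cover_edge u v (hs hu hv huv)
  obtain ⟨q, p, hqp, -, -⟩ := hpath v x hxv
  obtain ⟨q', p', hqp', hq', hp'⟩ := hpath u x hxu
  have hmem : top v ∈ (q'.append p').support :=
    D.isTree.2.support_subset_of_isPath hqp _ (by simp [Walk.mem_support_append_iff])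
  rcases (Walk.mem_support_append_iff _ _).1 hmem with h | h
  · exact hq' _ h
  · rcases hp' _ h with h | h
    · exact h ▸ htop u
    · exact absurd h (hvmax u hu).not_gt

theorem TreewidthAtMost.le_of_isNClique {V : Type*} {G : SimpleGraph V} {k m : ℕ}
    (h : G.TreewidthAtMost k) {s : Finset V} (hs : G.IsNClique (m + 1) s) : m ≤ k := by
  obtain ⟨ι, -, T, D, hD⟩ := h
  obtain ⟨t, ht⟩ := D.exists_bag_of_isClique s hs.1
  have := (Finset.card_le_card ht).trans (hD t)
  rw [hs.2] at this
  omega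

/-- Each vertex gets the bag of itself and its earlier neighbours; the extra root `none`, with empty
bag, ties the components together. -/
theorem HasEliminationOrder.treewidthAtMost {V : Type} [Finite V] {G : SimpleGraph V} {k : ℕ}
    (h : G.HasEliminationOrder k) : G.TreewidthAtMost k := by
  classical
  obtain ⟨L, hL⟩ := h
  set P : V → Set V := fun v => {a | G.Adj v a ∧ L a < L v} with hP
  have hfin : ∀ v, (P v).Finite := fun v => Set.toFinite _
  -- the parent of `v` is its latest earlier neighbour
  have hex : ∀ v, ∃ o : Option V, (o = none ∧ P v = ∅) ∨
      ∃ w, o = some w ∧ w ∈ P v ∧ ∀ a ∈ P v, L a ≤ L w := by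
    intro v
    rcases (P v).eq_empty_or_nonempty with h | h
    · exact ⟨none, Or.inl ⟨rfl, h⟩⟩
    · obtain ⟨w, hw, hmax⟩ := Set.exists_max_image _ L (hfin v) h
      exact ⟨some w, Or.inr ⟨w, rfl, hw, hmax⟩⟩
  choose par hpar using hex
  have hlt : ∀ v w, par v = some w → L w < L v := by
    intro v w hvw
    rcases hpar v with ⟨h, -⟩ | ⟨w', h, hw', -⟩
    · simp [h] at hvw
    · obtain rfl : w' = w := by simpa [h] using hvw
      exact hw'.2
  set T := fromEdgeSet (Set.range fun v => s(some v, par v)) with hT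
  have hadj : ∀ v, T.Adj (some v) (par v) := by
    intro v
    rw [hT, fromEdgeSet_adj]
    exact ⟨⟨v, rfl⟩, fun h => lt_irrefl _ (hlt v v h.symm)⟩
  let bag : Option V → Finset V := fun o => o.elim ∅ fun v => insert v (hfin v).toFinset
  have hbag : ∀ v x, x ∈ bag (some v) ↔ x = v ∨ x ∈ P v := by
    intro v x
    simp [bag]
  -- the nodes whose bags contain `x` are joined to `some x` by walks in such nodes
  have hwalk : ∀ x n v, L v = n → x ∈ bag (some v) →
      ∃ q : T.Walk (some v) (some x), ∀ y ∈ q.support, x ∈ bag y := by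
    intro x n
    induction n using Nat.strong_induction_on with
    | _ n ih =>
      rintro v rfl hx
      have hx' := (hbag _ _).1 hx
      by_cases hxv : x = v
      · subst hxv
        exact ⟨Walk.nil, by simpa using hx⟩
      have hxP := hx'.resolve_left hxv
      rcases hpar v with ⟨-, h⟩ | ⟨w, h, hw, hmax⟩
      · rw [h] at hxP
        exact hxP.elim
      -- Both `x` and `w` are earlier neighbours of `v`, hence equal or adjacent, and `w` is the
      -- latest.
      · have hxw : x ∈ bag (some w) := by
          rw [hbag]
          by_cases hxw : x = w
          · exact Or.inl hxw
          · exact Or.inr ⟨(hL v).1 hw hxP (Ne.symm hxw),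
              (hmax x hxP).lt_of_ne (L.injective.ne hxw)⟩
        obtain ⟨q, hq⟩ := ih _ hw.2 w rfl hxw
        refine ⟨Walk.cons (h ▸ hadj v) q, ?_⟩
        intro y hy
        rw [Walk.support_cons, List.mem_cons] at hy
        rcases hy with rfl | hy
        · exact hx
        · exact hq y hy
  have hwalk' : ∀ x o, x ∈ bag o →
      ∃ q : T.Walk o (some x), ∀ y ∈ q.support, x ∈ bag y := by
    rintro x (_ | v) hx
    · simp [bag] at hx
    · exact hwalk x _ v rfl hx
  have htree : T.IsTree := isTree_of_parent L par hlt
  refine ⟨Option V, inferInstance, T, ⟨htree, bag, ?_, ?_, ?_⟩, ?_⟩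
  · exact fun v => ⟨some v, (hbag v v).2 (Or.inl rfl)⟩
  · intro u v huv
    rcases lt_or_gt_of_ne (L.injective.ne huv.ne) with h | h
    · exact ⟨some v, (hbag _ _).2 (Or.inr ⟨huv.symm, h⟩), (hbag _ _).2 (Or.inl rfl)⟩
    · exact ⟨some u, (hbag _ _).2 (Or.inl rfl), (hbag _ _).2 (Or.inr ⟨huv, h⟩)⟩
  · intro a s b p hp hs x hxa hxb
    obtain ⟨q, hq⟩ := hwalk' x a hxa
    obtain ⟨q', hq'⟩ := hwalk' x b hxb
    have := htree.2.support_subset_of_isPath hp (q.append q'.reverse) hs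
    rcases (Walk.mem_support_append_iff _ _).1 this with h | h
    · exact hq s h
    · exact hq' s (by simpa using h)
  · rintro (_ | v)
    · simp [bag]
    · refine (Finset.card_insert_le _ _).trans (Nat.succ_le_succ ?_)
      rw [← Set.ncard_eq_toFinset_card _ (hfin v)]
      exact (hL v).2

theorem HasEliminationOrder.treewidth_eq {V : Type} [Fintype V] {G : SimpleGraph V} {k : ℕ}
    (h : G.HasEliminationOrder k) {s : Finset V} (hs : G.IsNClique (k + 1) s) :
    G.treewidth = k :=
  le_antisymm (Nat.sInf_le h.treewidthAtMost)
    (G.treewidthAtMost_treewidth.le_of_isNClique hs)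

/-! ### The construction -/

/-- The graph obtained from `G` by attaching, to each vertex `x` of `G`, `N` disjoint copies of `H`
all of whose vertices are joined to `x`. -/
def attachCopies {V W : Type*} (G : SimpleGraph V) (H : SimpleGraph W) (N : ℕ) :
    SimpleGraph (V ⊕ (V × Fin N) × W) where
  Adj
    | .inl a, .inl b => G.Adj a b
    | .inl a, .inr (x, _) => x.1 = a
    | .inr (x, _), .inl a => x.1 = a
    | .inr (x, w), .inr (y, z) => x = y ∧ H.Adj w z
  symm := ⟨by
    rintro (a | ⟨x, w⟩) (b | ⟨y, z⟩) h
    · exact Adj.symm h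
    · exact h
    · exact h
    · exact ⟨h.1.symm, Adj.symm h.2⟩⟩
  loopless := ⟨by
    rintro (a | ⟨x, w⟩) h
    · exact G.irrefl h
    · exact H.irrefl h.2⟩

section attachCopies

variable {V W : Type*} {G : SimpleGraph V} {H : SimpleGraph W} {N : ℕ}

/-- The base graph embeds into `attachCopies`. -/
def attachCopiesInl (G : SimpleGraph V) (H : SimpleGraph W) (N : ℕ) :
    G ↪g attachCopies G H N :=
  ⟨Function.Embedding.inl, Iff.rfl⟩

/-- Each of the attached copies embeds into `attachCopies`. -/
def attachCopiesInr (G : SimpleGraph V) (H : SimpleGraph W) (N : ℕ) (x : V × Fin N) :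
    H ↪g attachCopies G H N :=
  ⟨⟨fun w => .inr (x, w), fun _ _ h => congrArg Prod.snd (Sum.inr_injective h)⟩,
    ⟨fun h => h.2, fun h => ⟨rfl, h⟩⟩⟩

theorem HasEliminationOrder.attachCopies [Finite V] [Finite W] {k : ℕ}
    (hG : G.HasEliminationOrder (k + 1)) (hH : H.HasEliminationOrder k) (N : ℕ) :
    (attachCopies G H N).HasEliminationOrder (k + 1) := by
  obtain ⟨L₁, h₁⟩ := hG
  obtain ⟨L₂, h₂⟩ := hH
  obtain ⟨M, hM⟩ : ∃ M, ∀ v, L₁ v < M := by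
    obtain ⟨M, hM⟩ := (Set.finite_range L₁).bddAbove
    exact ⟨M + 1, fun v => Nat.lt_succ_of_le (hM ⟨v, rfl⟩)⟩
  obtain ⟨K, ⟨e⟩⟩ := Finite.exists_equiv_fin (V × Fin N)
  -- The base comes first, so a copy vertex gains only its anchor as an earlier neighbour. The
  -- copies are interleaved by `L₂`, with the copy's index as remainder modulo `K`.
  let f : V ⊕ (V × Fin N) × W → ℕ :=
    Sum.elim L₁ fun y => M + (K * L₂ y.2 + e y.1)
  have hf : Function.Injective f := by
    rintro (a | ⟨x, w⟩) (b | ⟨y, z⟩) h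
    · exact congrArg _ (L₁.injective h)
    · have h' : L₁ a = M + (K * L₂ z + e y) := h
      have := hM a
      omega
    · have h' : M + (K * L₂ w + e x) = L₁ b := h
      have := hM b
      omega
    · have h' : M + (K * L₂ w + e x) = M + (K * L₂ z + e y) := h
      have h' := Nat.add_left_cancel h'
      have hdiv := congrArg (· / K) h'
      have hmod := congrArg (· % K) h'
      have hK : 0 < K := (Nat.zero_le _).trans_lt (e x).2
      simp only [Nat.mul_add_div hK, Nat.div_eq_of_lt (e _).2, Nat.add_zero] at hdiv
      simp only [Nat.mul_add_mod, Nat.mod_eq_of_lt (e _).2] at hmod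
      rw [L₂.injective hdiv, e.injective (Fin.ext hmod)]
  refine ⟨⟨f, hf⟩, ?_⟩
  have hlow : ∀ a b, f (.inl a) < f (.inr b) := fun a b => (hM a).trans_le (Nat.le_add_right _ _)
  rintro (v | ⟨x, w⟩)
  · have : {a | (SimpleGraph.attachCopies G H N).Adj (.inl v) a ∧ f a < f (.inl v)} =
        Sum.inl '' {a | G.Adj v a ∧ L₁ a < L₁ v} := by
      ext (a | b)
      · simp only [Set.mem_ofPred_eq, Set.mem_image, Sum.inl.injEq, exists_eq_right]
        rfl
      · simp [(hlow v b).not_gt]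
    simp only [Function.Embedding.coeFn_mk, this]
    refine ⟨?_, ?_⟩
    · rintro _ ⟨a, ha, rfl⟩ _ ⟨b, hb, rfl⟩ hab
      exact (h₁ v).1 ha hb fun h => hab (congrArg _ h)
    · rw [Set.ncard_image_of_injective _ Sum.inl_injective]
      exact (h₁ v).2
  · have : {a | (SimpleGraph.attachCopies G H N).Adj (.inr (x, w)) a ∧ f a < f (.inr (x, w))} =
        insert (.inl x.1) ((fun z => .inr (x, z)) '' {a | H.Adj w a ∧ L₂ a < L₂ w}) := by
      ext (a | ⟨y, z⟩)
      · simp only [Set.mem_ofPred_eq, hlow, and_true, Set.mem_insert_iff, Sum.inl.injEq,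
          Set.mem_image, reduceCtorEq, and_false, exists_false, or_false]
        exact eq_comm
      · simp only [Set.mem_ofPred_eq, Set.mem_insert_iff, reduceCtorEq, false_or, Set.mem_image,
          Sum.inr.injEq, Prod.mk.injEq]
        have hxK := (e x).2
        constructor
        · rintro ⟨⟨rfl, h⟩, hlt⟩
          refine ⟨z, ⟨h, ?_⟩, rfl, rfl⟩
          have hlt' : M + (K * L₂ z + e x) < M + (K * L₂ w + e x) := hlt
          exact lt_of_mul_lt_mul_left (a := K) (by omega) (Nat.zero_le _)
        · rintro ⟨z, ⟨h, hlt⟩, rfl, rfl⟩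
          refine ⟨⟨rfl, h⟩, ?_⟩
          show M + (K * L₂ z + e x) < M + (K * L₂ w + e x)
          have := Nat.mul_lt_mul_of_pos_left hlt ((Nat.zero_le _).trans_lt hxK)
          omega
    simp only [Function.Embedding.coeFn_mk, this]
    refine ⟨?_, ?_⟩
    · rw [isClique_insert]
      refine ⟨?_, ?_⟩
      · rintro _ ⟨a, ha, rfl⟩ _ ⟨b, hb, rfl⟩ hab
        exact ⟨rfl, (h₂ w).1 ha hb fun h => hab (h ▸ rfl)⟩
      · rintro _ ⟨a, ha, rfl⟩ -
        rfl
    · refine (Set.ncard_insert_le _ _).trans (Nat.succ_le_succ ?_)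
      exact (Set.ncard_image_of_injective _ (attachCopiesInr G H N x).injective).trans_le (h₂ w).2

theorem exists_isNClique_attachCopies {m : ℕ} [Nonempty V] (hN : 0 < N)
    (h : ∃ s, H.IsNClique m s) : ∃ s, (attachCopies G H N).IsNClique (m + 1) s := by
  classical
  obtain ⟨s, hs⟩ := h
  obtain ⟨v⟩ := ‹Nonempty V›
  let g := attachCopiesInr G H N (v, ⟨0, hN⟩)
  refine ⟨insert (.inl v) (s.map g.toEmbedding), IsNClique.insert ⟨?_, ?_⟩ ?_⟩
  · rw [Finset.coe_map]
    rintro _ ⟨a, ha, rfl⟩ _ ⟨b, hb, rfl⟩ hab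
    exact g.map_rel_iff.2 (hs.1 ha hb fun h => hab (congrArg _ h))
  · rw [Finset.card_map, hs.2]
  · intro b hb
    obtain ⟨a, -, rfl⟩ := Finset.mem_map.1 hb
    rfl

end attachCopies

/-! ### The lower bound -/

theorem mem_wReach_map {V V' : Type*} {G : SimpleGraph V} {G' : SimpleGraph V'} (f : G ↪g G')
    {L : V' → ℕ} {r : ℕ} {u v : V} (h : u ∈ G.WReach (L ∘ f) r v) : f u ∈ G'.WReach L r (f v) := by
  obtain ⟨p, hp, hlen, hL⟩ := h
  refine ⟨p.map f.toHom, Walk.IsPath.map (f := f.toHom) f.injective hp, by simpa using hlen, ?_⟩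
  intro w hw
  rw [Walk.support_map, List.mem_map] at hw
  obtain ⟨x, hx, rfl⟩ := hw
  exact hL x hx

/-- For every order of the vertices, some vertex weakly `r`-reaches at least `c` vertices. -/
def WReachAtLeast {V : Type*} (G : SimpleGraph V) (r c : ℕ) : Prop :=
  ∀ L : V ↪ ℕ, ∃ v, c ≤ (G.WReach L r v).ncard

theorem WReachAtLeast.map {V V' : Type*} [Finite V'] {G : SimpleGraph V} {G' : SimpleGraph V'}
    {r c : ℕ} (h : G.WReachAtLeast r c) (f : G ↪g G') : G'.WReachAtLeast r c := by
  intro L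
  obtain ⟨v, hv⟩ := h (f.toEmbedding.trans L)
  refine ⟨f v, hv.trans ?_⟩
  rw [← Set.ncard_image_of_injective _ f.injective]
  refine Set.ncard_le_ncard ?_
  rintro _ ⟨u, hu, rfl⟩
  exact mem_wReach_map f hu

theorem WReachAtLeast.attachCopies {V W : Type*} [Finite V] [Finite W] {G : SimpleGraph V}
    {H : SimpleGraph W} {r c d N : ℕ} (hG : G.WReachAtLeast r c) (hH : H.WReachAtLeast (r + 1) d)
    (hN : c + d ≤ N) : (attachCopies G H N).WReachAtLeast (r + 1) (c + d) := by
  intro L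
  obtain ⟨x, hx⟩ := hG ((attachCopiesInl G H N).toEmbedding.trans L)
  by_cases hi : ∃ i : Fin N, ∀ w, L (.inl x) < L (.inr ((x, i), w))
  · obtain ⟨i, hi⟩ := hi
    let g := attachCopiesInr G H N (x, i)
    obtain ⟨w, hw⟩ := hH (g.toEmbedding.trans L)
    refine ⟨g w, (add_le_add hx hw).trans ?_⟩
    rw [← Set.ncard_image_of_injective _ (attachCopiesInl G H N).injective,
      ← Set.ncard_image_of_injective _ g.injective, ← Set.ncard_union_eq]
    · refine Set.ncard_le_ncard ?_
      rintro _ (⟨u, hu, rfl⟩ | ⟨u, hu, rfl⟩)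
      · obtain ⟨p, hp, hlen, hL⟩ := hu
        let q := p.map (attachCopiesInl G H N).toHom
        have hadj : (SimpleGraph.attachCopies G H N).Adj (g w) (attachCopiesInl G H N x) := rfl
        refine ⟨Walk.cons hadj q, ?_, ?_, ?_⟩
        · refine (Walk.IsPath.map (f := (attachCopiesInl G H N).toHom)
            (attachCopiesInl G H N).injective hp).cons ?_
          rw [Walk.support_map, List.mem_map]
          rintro ⟨y, -, hy⟩
          exact absurd hy Sum.inl_ne_inr
        · simpa [q] using hlen
        · intro y hy
          rw [Walk.support_cons, List.mem_cons] at hy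
          rcases hy with rfl | hy
          · exact (hL x p.start_mem_support).trans (hi w).le
          · rw [Walk.support_map, List.mem_map] at hy
            obtain ⟨z, hz, rfl⟩ := hy
            exact hL z hz
      · exact mem_wReach_map g hu
    · rw [Set.disjoint_left]
      rintro _ ⟨u, -, rfl⟩ ⟨z, -, hz⟩
      exact absurd hz Sum.inr_ne_inl
  · push Not at hi
    choose w hw using hi
    -- Every copy at `x` has a vertex before `x`, so `x` alone reaches `N` vertices.
    refine ⟨.inl x, hN.trans ?_⟩
    have hinj : Function.Injective fun i : Fin N =>
        (Sum.inr ((x, i), w i) : V ⊕ (V × Fin N) × W) := by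
      intro i j h
      exact congrArg (fun y => y.1.2) (Sum.inr_injective h)
    calc N = (Set.range fun i : Fin N =>
          (Sum.inr ((x, i), w i) : V ⊕ (V × Fin N) × W)).ncard := by
          rw [← Set.image_univ, Set.ncard_image_of_injective _ hinj, Set.ncard_univ,
            Nat.card_eq_fintype_card, Fintype.card_fin]
      _ ≤ _ := Set.ncard_le_ncard ?_
    rintro _ ⟨i, rfl⟩
    have hadj : (SimpleGraph.attachCopies G H N).Adj (.inl x) (.inr ((x, i), w i)) := rfl
    refine ⟨hadj.toWalk, ?_, ?_, ?_⟩
    · exact hadj.isPath_toWalk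
    · simp
    · intro y hy
      simp only [Walk.support_cons, Walk.support_nil, List.mem_cons, List.not_mem_nil,
        or_false] at hy
      rcases hy with rfl | rfl
      · exact hw i
      · exact le_rfl

theorem WReachAtLeast.le_wcol {V : Type*} [Fintype V] {G : SimpleGraph V} {r c : ℕ}
    (h : G.WReachAtLeast r c) : c ≤ G.wcol r := by
  have : Nonempty (V ↪ ℕ) := ⟨(Fintype.equivFin V).toEmbedding.trans Fin.valEmbedding⟩
  refine le_ciInf fun L => ?_
  obtain ⟨v, hv⟩ := h L
  exact hv.trans (Finset.le_sup (f := fun v => (G.WReach L r v).ncard) (Finset.mem_univ v))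

theorem wReachAtLeast_one {V : Type*} [Finite V] [Nonempty V] (G : SimpleGraph V) (r : ℕ) :
    G.WReachAtLeast r 1 := by
  intro L
  obtain ⟨v⟩ := ‹Nonempty V›
  refine ⟨v, (Set.ncard_pos (Set.toFinite _)).2 ⟨v, Walk.nil, by simp, by simp, by simp⟩⟩

theorem hasEliminationOrder_of_subsingleton {V : Type*} [Finite V] [Subsingleton V]
    (G : SimpleGraph V) (k : ℕ) : G.HasEliminationOrder k := by
  refine ⟨⟨fun _ => 0, Function.injective_of_subsingleton _⟩, fun v => ?_⟩
  simp

/-- The clique needs `0 < r`, because the graph for `r = 0` is a single vertex. Smaller radii are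
inherited from the embedded graph of the previous stage. -/
theorem exists_graph_extremal (k r : ℕ) :
    ∃ (V : Type) (_ : Fintype V) (_ : Nonempty V) (G : SimpleGraph V),
      G.HasEliminationOrder k ∧ (0 < r → ∃ s, G.IsNClique (k + 1) s) ∧
      ∀ r' ≤ r, G.WReachAtLeast r' ((r' + k).choose k) := by
  induction k generalizing r with
  | zero =>
    refine ⟨Unit, inferInstance, inferInstance, ⊥, hasEliminationOrder_of_subsingleton _ _,
      fun _ => ⟨{()}, by simp⟩, fun r' _ => ?_⟩
    simpa using wReachAtLeast_one _ r'
  | succ k ihk =>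
    induction r with
    | zero =>
      refine ⟨Unit, inferInstance, inferInstance, ⊥, hasEliminationOrder_of_subsingleton _ _,
        fun h => absurd h (lt_irrefl _), fun r' hr' => ?_⟩
      obtain rfl : r' = 0 := by omega
      simpa using wReachAtLeast_one _ 0
    | succ r ihr =>
      obtain ⟨V, _, _, G, hG, -, hGr⟩ := ihr
      obtain ⟨W, _, _, H, hH, hHc, hHr⟩ := ihk (r + 1)
      have hpos : 0 < (r + (k + 1)).choose (k + 1) := Nat.choose_pos (by omega)
      refine ⟨_, inferInstance, inferInstance, SimpleGraph.attachCopies G H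
        ((r + (k + 1)).choose (k + 1) + (r + 1 + k).choose k), hG.attachCopies hH _,
        fun _ => exists_isNClique_attachCopies (by omega) (hHc r.succ_pos), fun r' hr' => ?_⟩
      rcases hr'.lt_or_eq with h | rfl
      · exact (hGr r' (by omega)).map (attachCopiesInl G H _)
      · have := (hGr r le_rfl).attachCopies (hHr (r + 1) le_rfl) le_rfl
        rwa [show (r + 1 + (k + 1)).choose (k + 1) =
            (r + (k + 1)).choose (k + 1) + (r + 1 + k).choose k by
          rw [show r + 1 + (k + 1) = (r + k + 1) + 1 by omega, Nat.choose_succ_succ, add_comm,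
            show r + 1 + k = r + k + 1 by omega, show r + (k + 1) = r + k + 1 by omega]]

end SimpleGraph

theorem mainTheorem4 (k r : ℕ) :
    ∃ (V : Type) (_ : Fintype V) (G : SimpleGraph V),
      G.treewidth = k ∧ ∀ r' : ℕ, r' ≤ r → G.wcol r' = (r' + k).choose k := by
  -- Radius `r + 1` guarantees the clique even when `r = 0`.
  obtain ⟨V, _, _, G, hG, hc, hr⟩ := SimpleGraph.exists_graph_extremal k (r + 1)
  obtain ⟨s, hs⟩ := hc r.succ_pos
  exact ⟨V, inferInstance, G, hG.treewidth_eq hs, fun r' hr' =>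
    le_antisymm (hG.wcol_le r') (hr r' (by omega)).le_wcol⟩
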